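/- Let $\mathcal T$ be a triangulated category with suspension $\Sigma$ (for instance $\mathcal T=\mathrm{Ho}(\mathcal C)$ for a stable model category $\mathcal C$; an isomorphism in $\mathcal T$ is then the class of a weak equivalence). Let $f_\bullet:C_\bullet\to D_\bullet$ be a map of simplicial objects of $\mathcal T$, and let $C_*,D_*$ be the alternating sum complexes, with differentials $d^C,d^D$. *Totalizations.* A totalization of $C_\bullet$ is a sequence $0=\mathrm{Tot}(\mathcal F_{-1}C_*)\to \mathrm{Tot}(\mathcal F_0C_*)\to\mathrm{Tot}(\mathcal F_1C_*)\to\cdots$ with distinguished triangles $\mathrm{Tot}(\mathcal F_{m-1}C_*)\to\mathrm{Tot}(\mathcal F_{m}C_*)\to\Sigma^mC_m\xrightarrow{\partial_m}\Sigma\,\mathrm{Tot}(\mathcal F_{m-1}C_*)$ such that $\partial_{m+1}$ followed by $\Sigma\,\mathrm{Tot}(\mathcal F_{m}C_*)\to\Sigma\Sigma^{m}C_{m}$ is $\Sigma^{m+1}d^C_{m+1}$, together with its homotopy colimit $\mathrm{Tot}(C_*)$ (the cone of $1-\mathrm{shift}$ on $\bigoplus_m\mathrm{Tot}(\mathcal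 F_mC_*)$). Fix totalizations of $C_\bullet$ and $D_\bullet$. For $n\ge0$, $j\ge 0$ let $G^j_n(C)=\mathrm{Tot}(\mathcal F_{n+j-1}C_*/\mathcal F_{n-1}C_*)$, a cofiber of $\mathrm{Tot}(\mathcal F_{n-1}C_*)\to\mathrm{Tot}(\mathcal F_{n+j-1}C_*)$, be the part with cells in degrees $n,\dots,n+j-1$; by the octahedral axiom these objects can be and are arranged in a tower $0=G_n^0(C)\to G^1_n(C)\to G_n^2(C)\to\cdots$ with triangles $G^{j}_n(C)\to G^{j+1}_n(C)\to\Sigma^{n+j}C_{n+j}\xrightarrow{\partial}\Sigma G^{j}_n(C)$ compatible with those above. The same notation is used for $D$. A *filtration-preserving map* $G^k_n(C)\to G^k_n(D)$ *extending* $f_\bullet$ is a family $g^j:G^j_n(C)\to G^j_n(D)$, $0\le j\le k$, such that $(g^j,g^{j+1},\Sigma^{n+j}f_{n+j})$ is a morphism of triangles for every $0\le j<k$; filtration-preserving maps of the totalizations $\mathrm{Tot}(\mathcal F_m)$ are defined likewise, and a filtration-preserving map $\mathrm{Tot}(C_*)\to\mathrm{Tot}(D_*)$ is a map together with such a family on all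 $\mathrm{Tot}(\mathcal F_m)$, commuting with the maps $\mathrm{Tot}(\mathcal F_m)\to\mathrm{Tot}$. *Brackets.* A system of nulhomotopies in degrees $\ge n$ consists of successive choices as follows. One chooses maps $g^j:G^j_n(C)\to G^j_n(D)$, where $g^{j+1}$ is an extension of $g^{j}$ over the cell of degree $n+j$ (in the above sense) if there is one. For each $m\ge n$, with $j=m-n$, let $\delta_m=(\Sigma g^{j})\,\partial-\partial\,(\Sigma^mf_m):\Sigma^mC_m\to\Sigma G^{j}_n(D)$ be the defect of commutativity with the attaching maps; one chooses maps $\lambda_{m,i}:\Sigma^mC_m\to\Sigma\,G^{i-n}_n(D)$, with $\lambda_{m,m}=\delta_m$ and with $\lambda_{m,i}$, for $n<i<m$, a lift of $\lambda_{m,i+1}$ if there is one. For $N\ge1$, $i\ge n$ the bracket $T(N,i;f_\bullet):\Sigma^{N-1}C_{i+N}\to D_i$ of the system is the $(i+1)$-fold desuspension of the composite of $\lambda_{i+N,i+1}$ with the projection $\Sigma\,G^{i+1-n}_n(D)\to\Sigma\Sigma^iD_i$. Thus $\lambda_{i+N,i}$ is a nulhomotopy of $T(N,i;f_\bullet)$,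 and $T(N,i;f_\bullet)$ arises from a nulhomotopy $\lambda_{i+N,i+1}$ of $T(N-1,i+1;f_\bullet)$ and one of $T(N-1,i;f_\bullet)$ contained in $g^{i+N-n}$. The bracket $T(N,i;f_\bullet)$ is *defined* if all these choices could be made: the maps $g^j$, $0\le j\le i+N-n$, form a filtration-preserving map extending $f_\bullet$, and $\lambda_{i+N,j}$ is a lift of $\lambda_{i+N,j+1}$ for $i<j<i+N$. Brackets in a given range *vanish* if they are all zero for one and the same system. **Theorem.** 1. Let $n\ge 0$ and $k\ge3$. There is a filtration-preserving map $G_n^k(C)\to G^k_n(D)$ extending $f_\bullet$ if and only if the brackets $T(N,i;f_\bullet)$ with $2\le N<k$, $n\le i$, $N+i<n+k$ vanish (for some system in degrees $\ge n$). 2. If, for a system in degrees $\ge n$, the brackets $T(N,i;f_\bullet)$ with $2\le N<k$, $n\le i$ and $N+i\le n+k$ vanish, then its next bracket $T(k,n;f_\bullet):\Sigma^{k-1}C_{n+k}\to D_n$ is defined; it arises from the nulhomotopies of $T(k-1,n+1;f_\bullet)$ and $T(k-1,n;f_\bullet)$. 3. If there is a system in degrees $\ge0$ (for the towers $\mathrm{Tot}(\mathcal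 F_m)$) all of whose brackets $T(N,i;f_\bullet)$, $N\ge2$, $i\ge0$, vanish, then there is a filtration-preserving map $\mathrm{Tot}(C_*)\to\mathrm{Tot}(D_*)$ which is $\Sigma^mf_m$ on the $m$-th filtration quotient for each $m$. 4. If every $f_m$ is an isomorphism (a weak equivalence), then every filtration-preserving map $G_n^k(C)\to G_n^k(D)$ extending $f_\bullet$, and every filtration-preserving map of the $\mathrm{Tot}(\mathcal F_m)$ extending $f_\bullet$, is an isomorphism at each stage. -/

import Mathlib

open CategoryTheory CategoryTheory.Limits CategoryTheory.Pretriangulated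
open Opposite AlgebraicTopology
open scoped Simplicial

universe v u

namespace TotObstruction

noncomputable section

section

variable {𝒯 : Type u} [Category.{v} 𝒯] [HasZeroObject 𝒯] [HasShift 𝒯 ℤ] [Preadditive 𝒯]
  [∀ n : ℤ, (shiftFunctor 𝒯 n).Additive] [Pretriangulated 𝒯]

/-- The `m`-th cell `Σ^m K_m` of a complex `K` in the triangulated category. -/
abbrev cell (K : ChainComplex 𝒯 ℕ) (m : ℕ) : 𝒯 := (K.X m)⟦(m : ℤ)⟧

/-- The map `Σ^m φ_m` on cells. -/
abbrev cellMap {K L : ChainComplex 𝒯 ℕ} (φ : K ⟶ L) (m : ℕ) : cell K m ⟶ cell L m :=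
  (φ.f m)⟦(m : ℤ)⟧'

/-- The map `Σ^(m+1) d : Σ^(m+1) K_(m+1) ⟶ Σ (Σ^m K_m)`. -/
def cellDiff (K : ChainComplex 𝒯 ℕ) (m : ℕ) : cell K (m + 1) ⟶ (cell K m)⟦(1 : ℤ)⟧ :=
  (K.d (m + 1) m)⟦((m + 1 : ℕ) : ℤ)⟧' ≫
    (shiftFunctorAdd' 𝒯 (m : ℤ) 1 ((m + 1 : ℕ) : ℤ) (by push_cast; rfl)).hom.app (K.X m)

/-- A geometric realization tower with one cell `Σ^i K_i` for every `i ≥ n`: the object `obj m`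
is built from the cells `Σ^i K_i` with `n ≤ i < m`, it sits in distinguished triangles
`obj m ⟶ obj (m+1) ⟶ Σ^m K_m ⟶ Σ (obj m)`, and the attaching map of a cell, projected to the
cell just below, is the differential of `K`. Only the indices `m ≥ n` matter. -/
structure CellTower (K : ChainComplex 𝒯 ℕ) (n : ℕ) where
  obj : ℕ → 𝒯
  isZero : IsZero (obj n)
  incl (m : ℕ) : obj m ⟶ obj (m + 1)
  proj (m : ℕ) : obj (m + 1) ⟶ cell K m
  bd (m : ℕ) : cell K m ⟶ (obj m)⟦(1 : ℤ)⟧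
  dist (m : ℕ) (hm : n ≤ m) : Triangle.mk (incl m) (proj m) (bd m) ∈ distTriang 𝒯
  bd_proj (m : ℕ) (hm : n ≤ m) : bd (m + 1) ≫ (proj m)⟦(1 : ℤ)⟧' = cellDiff K m

/-- The composite `obj a ⟶ obj b` of the maps of the tower, for `a ≤ b`. -/
def CellTower.map {K : ChainComplex 𝒯 ℕ} {n : ℕ} (T : CellTower K n) {a b : ℕ} (h : a ≤ b) :
    T.obj a ⟶ T.obj b :=
  (Functor.ofSequence T.incl).map (homOfLE h)

/-- A totalization of a simplicial object `C` of the triangulated category: a tower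
`0 = Tot F_{-1} ⟶ Tot F_0 ⟶ Tot F_1 ⟶ ⋯` over the alternating sum complex of `C`
(`tower.obj m` is `Tot F_{m-1}`) together with its homotopy colimit `tot`, that is, a
distinguished triangle `⨁ Tot F_m ⟶ ⨁ Tot F_m ⟶ tot ⟶` whose first map is `1 - shift`. -/
structure Totalization (C : SimplicialObject 𝒯) where
  tower : CellTower ((alternatingFaceMapComplex 𝒯).obj C) 0
  sum : Cofan tower.obj
  isColimit : IsColimit sum
  tot : 𝒯
  fromSum : sum.pt ⟶ tot
  conn : tot ⟶ sum.pt⟦(1 : ℤ)⟧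
  dist : Triangle.mk
    (𝟙 sum.pt - Cofan.IsColimit.desc isColimit (fun m => tower.incl m ≫ sum.inj (m + 1)))
    fromSum conn ∈ distTriang 𝒯

/-- The map `Tot F_{m-1} ⟶ Tot` from a stage of the filtration to the homotopy colimit. -/
def Totalization.ι {C : SimplicialObject 𝒯} (T : Totalization C) (m : ℕ) :
    T.tower.obj m ⟶ T.tot :=
  T.sum.inj m ≫ T.fromSum

/-- The filtered subquotients of a tower with all cells of degree at least `n`: `obj m` is a
cofiber of `T.obj n ⟶ T.obj m` for `m ≥ n`, thus the totalization of the part of the complex in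
degrees `n, …, m - 1`. The maps between these cofibers and the triangles containing them are those
of the octahedral axiom for `T.obj n ⟶ T.obj m ⟶ T.obj (m+1)`. -/
structure GrTower {K : ChainComplex 𝒯 ℕ} (T : CellTower K 0) (n : ℕ) extends CellTower K n where
  quot (m : ℕ) : T.obj m ⟶ obj m
  conn (m : ℕ) : obj m ⟶ (T.obj n)⟦(1 : ℤ)⟧
  quot_dist (m : ℕ) (hm : n ≤ m) :
    Triangle.mk (T.map hm) (quot m) (conn m) ∈ distTriang 𝒯
  quot_incl (m : ℕ) (hm : n ≤ m) : quot m ≫ incl m = T.incl m ≫ quot (m + 1)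
  incl_conn (m : ℕ) (hm : n ≤ m) : incl m ≫ conn (m + 1) = conn m
  quot_proj (m : ℕ) (hm : n ≤ m) : quot (m + 1) ≫ proj m = T.proj m
  conn_map (m : ℕ) (hm : n ≤ m) : conn (m + 1) ≫ (T.map hm)⟦(1 : ℤ)⟧' = proj m ≫ T.bd m
  bd_quot (m : ℕ) (hm : n ≤ m) : T.bd m ≫ (quot m)⟦(1 : ℤ)⟧' = bd m

/-- By the octahedral axiom, the filtered subquotients of a tower exist. -/
theorem GrTower.nonempty [IsTriangulated 𝒯] {K : ChainComplex 𝒯 ℕ} (T : CellTower K 0) (n : ℕ) :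
    Nonempty (GrTower T n) := by
  classical
  have H : ∀ m, ∃ (Z : 𝒯) (q : T.obj m ⟶ Z) (c : Z ⟶ (T.obj n)⟦(1 : ℤ)⟧),
      ∀ h : n ≤ m, Triangle.mk (T.map h) q c ∈ distTriang 𝒯 := by
    intro m
    by_cases h : n ≤ m
    · obtain ⟨Z, q, c, d⟩ := Pretriangulated.distinguished_cocone_triangle (T.map h)
      exact ⟨Z, q, c, fun _ => d⟩
    · exact ⟨T.obj m, 0, 0, fun h' => (h h').elim⟩
  choose Z q c d using H
  have hmap (m : ℕ) (h : n ≤ m) : T.map h ≫ T.incl m = T.map (h.trans (Nat.le_succ m)) := by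
    have h1 : T.incl m = T.map (Nat.le_succ m) :=
      (Functor.ofSequence_map_homOfLE_succ T.incl m).symm
    rw [h1]
    exact ((Functor.ofSequence T.incl).map_comp (homOfLE h) (homOfLE (Nat.le_succ m))).symm
  have hO (m : ℕ) (h : n ≤ m) : Nonempty (Triangulated.Octahedron (hmap m h) (d m h)
      (T.dist m (Nat.zero_le m)) (d (m + 1) (h.trans (Nat.le_succ m)))) :=
    IsTriangulated.octahedron_axiom _ _ _ _
  have O (m : ℕ) (h : n ≤ m) := (hO m h).some
  have hz : IsZero (Z n) := by
    have h1 : T.map (le_refl n) = 𝟙 _ := (Functor.ofSequence T.incl).map_id n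
    refine (Triangle.isZero₃_iff_isIso₁ _ (d n le_rfl)).2 ?_
    change IsIso (T.map (le_refl n))
    rw [h1]
    infer_instance
  refine ⟨{ obj := Z, isZero := hz, quot := q, conn := c, quot_dist := d
            incl := fun m => if h : n ≤ m then (O m h).m₁ else 0
            proj := fun m => if h : n ≤ m then (O m h).m₃ else 0
            bd := fun m => T.bd m ≫ (q m)⟦(1 : ℤ)⟧'
            dist := ?_, bd_proj := ?_, quot_incl := ?_, incl_conn := ?_, quot_proj := ?_
            conn_map := ?_, bd_quot := fun _ _ => rfl }⟩
  · intro m h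
    rw [dif_pos h, dif_pos h]
    exact (O m h).mem
  · intro m h
    rw [dif_pos h, Category.assoc, ← Functor.map_comp, (O m h).comm₃]
    exact T.bd_proj m (Nat.zero_le m)
  · intro m h
    rw [dif_pos h]
    exact (O m h).comm₁
  · intro m h
    rw [dif_pos h]
    exact (O m h).comm₂
  · intro m h
    rw [dif_pos h]
    exact (O m h).comm₃
  · intro m h
    rw [dif_pos h]
    exact (O m h).comm₄

section Maps

variable {K L : ChainComplex 𝒯 ℕ} (φ : K ⟶ L) {n : ℕ} (A : CellTower K n) (B : CellTower L n)

/-- `b` extends `a` over the `m`-th cell, where it is `Σ^m φ_m`: the three maps `a`, `b` and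
`Σ^m φ_m` form a morphism of distinguished triangles. -/
def IsExtension (m : ℕ) (a : A.obj m ⟶ B.obj m) (b : A.obj (m + 1) ⟶ B.obj (m + 1)) : Prop :=
  A.incl m ≫ b = a ≫ B.incl m ∧
  A.proj m ≫ cellMap φ m = b ≫ B.proj m ∧
  A.bd m ≫ a⟦(1 : ℤ)⟧' = cellMap φ m ≫ B.bd m

/-- The maps `g m`, for `n ≤ m ≤ b`, form a filtration-preserving map `A.obj b ⟶ B.obj b` which on
the filtration quotients `Σ^m K_m ⟶ Σ^m L_m`, for `n ≤ m < b`, is given by `φ_m`. -/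
def IsFilteredMap (g : ∀ m, A.obj m ⟶ B.obj m) (b : ℕ) : Prop :=
  ∀ m, n ≤ m → m < b → IsExtension φ A B m (g m) (g (m + 1))

/-- The difference of the two composites in the square formed by the attaching maps of the `m`-th
cells, `Σ^m φ_m` and `g m`. -/
def attachingDefect (g : ∀ m, A.obj m ⟶ B.obj m) (m : ℕ) : cell K m ⟶ (B.obj m)⟦(1 : ℤ)⟧ :=
  A.bd m ≫ (g m)⟦(1 : ℤ)⟧' - cellMap φ m ≫ B.bd m

/-- The data of successive choices of nulhomotopies: maps `ext m` between the stages of the towers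
and, for every `m`, maps `lift m j` from the `m`-th cell to the (suspended) stages of the second
tower. The conditions on them are stated in `NullhomotopySystem`. -/
structure NullhomotopyData where
  ext (m : ℕ) : A.obj m ⟶ B.obj m
  lift (m j : ℕ) : cell K m ⟶ (B.obj j)⟦(1 : ℤ)⟧

variable {A B}

/-- The Toda bracket `T(N,i) : Σ^(N-1) K_(i+N) ⟶ L_i`: the map whose `(i+1)`-st suspension is the
composite `Σ^(i+N) K_(i+N) ⟶ Σ (B.obj (i+1)) ⟶ Σ (Σ^i L_i)` of `lift (i+N) (i+1)` and the
projection to the top cell. -/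
def NullhomotopyData.toda (S : NullhomotopyData A B) (N i : ℕ) :
    (K.X (i + N))⟦(N : ℤ) - 1⟧ ⟶ L.X i :=
  (shiftFunctor 𝒯 ((i : ℤ) + 1)).preimage
    ((shiftFunctorAdd' 𝒯 ((N : ℤ) - 1) ((i : ℤ) + 1) ((i + N : ℕ) : ℤ)
        (by push_cast; ring)).inv.app (K.X (i + N)) ≫
      S.lift (i + N) (i + 1) ≫ (B.proj i)⟦(1 : ℤ)⟧' ≫
      (shiftFunctorAdd' 𝒯 (i : ℤ) 1 ((i : ℤ) + 1) rfl).inv.app (L.X i))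

variable (A B)

/-- A system of choices of nulhomotopies for a map `φ` of complexes, in degrees at least `n`.

* `lift m m` is the attaching defect of `ext m`, the obstruction to extending `ext m` over the
  `m`-th cell, and `ext (m+1)` is such an extension if there is one.
* The map `lift (i+N) (i+1)` represents `T(N,i)`. A nulhomotopy of `T(N,i)` is a lift of this map
  along `Σ (B.obj i) ⟶ Σ (B.obj (i+1))`, the fiber of the projection to `Σ (Σ^i L_i)`; the map
  `lift (i+N) i` is such a lift if there is one.

So `T(N,i)` arises from a nulhomotopy of `T(N-1,i+1)`, recorded by `lift (i+N) (i+1)`, and from one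
of `T(N-1,i)`, recorded by `ext (i+N)`; and `T(1,i)` is the class of `φ d - d φ`, which is zero.
Such systems always exist: where no choice is possible, no condition is imposed, and the brackets
depending on that choice are not defined in the sense of `NullhomotopySystem.IsDefined`. -/
structure NullhomotopySystem extends NullhomotopyData A B where
  lift_self (m : ℕ) (hm : n ≤ m) : lift m m = attachingDefect φ A B ext m
  lift_spec (m j : ℕ) (hj : n < j) (hm : j < m)
    (h : ∃ l : cell K m ⟶ (B.obj j)⟦(1 : ℤ)⟧, l ≫ (B.incl j)⟦(1 : ℤ)⟧' = lift m (j + 1)) :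
    lift m j ≫ (B.incl j)⟦(1 : ℤ)⟧' = lift m (j + 1)
  ext_spec (m : ℕ) (hm : n ≤ m) (h : ∃ b, IsExtension φ A B m (ext m) b) :
    IsExtension φ A B m (ext m) (ext (m + 1))

variable {φ A B}

/-- `T(N,i)` is defined: all nulhomotopies that enter into it have been found. These are
the maps `ext` up to the stage `i + N` and the successive lifts of the attaching defect of
`ext (i+N)` to `Σ (B.obj (i+1))`. -/
def NullhomotopySystem.IsDefined (S : NullhomotopySystem φ A B) (N i : ℕ) : Prop :=
  IsFilteredMap φ A B S.ext (i + N) ∧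
  ∀ j, i < j → j < i + N →
    S.lift (i + N) j ≫ (B.incl j)⟦(1 : ℤ)⟧' = S.lift (i + N) (j + 1)

end Maps

end

end

end TotObstruction

open TotObstruction

namespace TotObstruction

/-! This is obstruction theory cell by cell. By completion of morphisms of triangles, a map of
stages extends over the next cell exactly when its attaching defect is zero
(`exists_isExtension_iff`).

The defect is tested against the filtration of the target. A map into a suspended stage lifts one
stage down once its projection to the top cell vanishes. For the defect itself this projection
vanishes because the map is a chain map (`attachingDefect_comp_proj`); for each later lift it is, up
to suspension, a bracket. If all brackets out of a cell vanish, the descent ends at the zero object,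
so every lift is zero, the defect included (`NullhomotopySystem.lift_eq_zero`). Induction over the
cells gives `NullhomotopySystem.isFilteredMap`.

Conversely, a filtered map has zero defects, and zero lifts of them give zero brackets
(`exists_nullhomotopySystem`). For the homotopy colimit, the compatible stages commute with `1 -
shift` and so induce a map of cones. Isomorphisms propagate up the tower by two-out-of-three for
triangles. -/

/-- Successive choices downwards from a given element, each as good as possible. -/
theorem exists_descending_choices {X : ℕ → Type*} [∀ j, Nonempty (X j)]
    (P : ∀ j, X (j + 1) → X j → Prop) (m : ℕ) (x : X m) :
    ∃ f : ∀ j, X j, f m = x ∧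
      ∀ j < m, (∃ y, P j (f (j + 1)) y) → P j (f (j + 1)) (f j) := by
  classical
  induction m with
  | zero =>
    exact ⟨Function.update (fun j => Classical.arbitrary (X j)) 0 x, by simp, by simp⟩
  | succ m ih =>
    obtain ⟨y, hy⟩ : ∃ y, (∃ z, P m x z) → P m x y := by
      by_cases h : ∃ z, P m x z
      · exact ⟨h.choose, fun _ => h.choose_spec⟩
      · exact ⟨Classical.arbitrary _, fun h' => (h h').elim⟩
    obtain ⟨f, hf, hf'⟩ := ih y
    refine ⟨Function.update f (m + 1) x, by simp, fun j hj => ?_⟩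
    obtain rfl | hj := Nat.eq_or_lt_of_le (Nat.le_of_lt_succ hj)
    · rw [Function.update_self, Function.update_of_ne (by omega), hf]
      exact hy
    · rw [Function.update_of_ne (by omega), Function.update_of_ne (by omega)]
      exact hf' j hj

/-- Successive choices upwards that continue a given sequence beyond the index `b`, each as good
as possible. -/
theorem exists_ascending_choices {X : ℕ → Type*} (P : ∀ j, X j → X (j + 1) → Prop)
    (g : ∀ j, X j) (b : ℕ) :
    ∃ f : ∀ j, X j, (∀ j ≤ b, f j = g j) ∧
      ∀ j, b ≤ j → (∃ y, P j (f j) y) → P j (f j) (f (j + 1)) := by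
  classical
  -- The default `g (j + 1)` serves two purposes: it copies `g` up to `b`, and it fills in where no
  -- admissible choice exists.
  let next (j : ℕ) (x : X j) : X (j + 1) :=
    if h : b ≤ j ∧ ∃ y, P j x y then h.2.choose else g (j + 1)
  refine ⟨fun j => Nat.rec (g 0) next j, fun j hj => ?_, fun j hj h => ?_⟩
  · cases j with
    | zero => rfl
    | succ j => exact dif_neg fun h => by omega
  · have h' := And.intro hj h
    change P j _ (next j _)
    simp only [next]
    rw [dif_pos h']
    exact h'.2.choose_spec

theorem cellDiff_naturality {𝒯 : Type u} [Category.{v} 𝒯] [HasShift 𝒯 ℤ] [Preadditive 𝒯]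
    {K L : ChainComplex 𝒯 ℕ} (φ : K ⟶ L) (m : ℕ) :
    cellDiff K m ≫ (cellMap φ m)⟦(1 : ℤ)⟧' = cellMap φ (m + 1) ≫ cellDiff L m := by
  have h := (shiftFunctorAdd' 𝒯 (m : ℤ) 1 ((m + 1 : ℕ) : ℤ) (by push_cast; rfl)).hom.naturality
    (φ.f m)
  dsimp only [Functor.comp_map] at h
  rw [cellDiff, cellDiff, Category.assoc, ← h, ← Category.assoc, ← Category.assoc,
    ← Functor.map_comp, ← Functor.map_comp, φ.comm]

section

variable {𝒯 : Type u} [Category.{v} 𝒯] [HasZeroObject 𝒯] [HasShift 𝒯 ℤ] [Preadditive 𝒯]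
  [∀ n : ℤ, (shiftFunctor 𝒯 n).Additive] [Pretriangulated 𝒯]

/-! ### Lifting along the towers and obstructions to extension -/

/-- Exactness of the twice rotated triangle, whose maps are `-u⟦1⟧'` and `-v⟦1⟧'`; hence the signs
in the proof. -/
theorem exists_lift_shift_of_dist {X Y Z W : 𝒯} {u : X ⟶ Y} {v : Y ⟶ Z} {w : Z ⟶ X⟦(1 : ℤ)⟧}
    (h : Triangle.mk u v w ∈ distTriang 𝒯) (l : W ⟶ Y⟦(1 : ℤ)⟧) (hl : l ≫ v⟦(1 : ℤ)⟧' = 0) :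
    ∃ l' : W ⟶ X⟦(1 : ℤ)⟧, l' ≫ u⟦(1 : ℤ)⟧' = l := by
  obtain ⟨(l' : W ⟶ X⟦(1 : ℤ)⟧), (h' : l = l' ≫ (-(u⟦(1 : ℤ)⟧')))⟩ :=
    Triangle.coyoneda_exact₃ _
    (rot_of_distTriang _ (rot_of_distTriang _ h)) l (by
      change l ≫ (-(v⟦(1 : ℤ)⟧')) = 0
      rw [Preadditive.comp_neg, hl, neg_zero])
  refine ⟨-l', ?_⟩
  rw [h', Preadditive.neg_comp, Preadditive.comp_neg]

section Maps

variable {K L : ChainComplex 𝒯 ℕ} {φ : K ⟶ L} {n : ℕ} {A : CellTower K n} {B : CellTower L n}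

theorem exists_isExtension_iff (g : ∀ m, A.obj m ⟶ B.obj m) {m : ℕ} (hm : n ≤ m) :
    (∃ b, IsExtension φ A B m (g m) b) ↔ attachingDefect φ A B g m = 0 := by
  constructor
  · rintro ⟨b, -, -, h⟩
    exact sub_eq_zero.2 h
  · intro h
    obtain ⟨b, h₁, h₂⟩ := complete_distinguished_triangle_morphism₂ _ _ (A.dist m hm)
      (B.dist m hm) (g m) (cellMap φ m) (sub_eq_zero.1 h)
    exact ⟨b, h₁, h₂, sub_eq_zero.1 h⟩

/-- The attaching defect vanishes on the cell just below, because `φ` commutes with the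
differentials. -/
theorem attachingDefect_comp_proj {g : ∀ m, A.obj m ⟶ B.obj m} {m : ℕ} (hm : n ≤ m)
    (h : IsExtension φ A B m (g m) (g (m + 1))) :
    attachingDefect φ A B g (m + 1) ≫ (B.proj m)⟦(1 : ℤ)⟧' = 0 := by
  rw [attachingDefect, Preadditive.sub_comp, Category.assoc, Category.assoc, B.bd_proj m hm,
    ← Functor.map_comp, ← h.2.1, Functor.map_comp, ← Category.assoc, A.bd_proj m hm,
    cellDiff_naturality, sub_self]

/-- The desuspension and the shift isomorphisms in the definition of the bracket do not affect
vanishing. -/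
theorem NullhomotopyData.toda_eq_zero_iff (S : NullhomotopyData A B) (N i : ℕ) :
    S.toda N i = 0 ↔ S.lift (i + N) (i + 1) ≫ (B.proj i)⟦(1 : ℤ)⟧' = 0 := by
  rw [NullhomotopyData.toda, ← (shiftFunctor 𝒯 ((i : ℤ) + 1)).map_eq_zero_iff,
    Functor.map_preimage, Preadditive.IsIso.comp_left_eq_zero, ← Category.assoc,
    Preadditive.IsIso.comp_right_eq_zero]

theorem exists_nullhomotopySystem (g : ∀ m, A.obj m ⟶ B.obj m) (b : ℕ)
    (hg : IsFilteredMap φ A B g b) :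
    ∃ S : NullhomotopySystem φ A B, ∀ m j, n ≤ m → m < b → S.lift m j = 0 := by
  classical
  obtain ⟨e, he, he'⟩ := exists_ascending_choices (IsExtension φ A B) g b
  have H (m : ℕ) : ∃ l : ∀ j, cell K m ⟶ (B.obj j)⟦(1 : ℤ)⟧,
      l m = attachingDefect φ A B e m ∧
      (∀ j < m, (∃ l', l' ≫ (B.incl j)⟦(1 : ℤ)⟧' = l (j + 1)) →
        l j ≫ (B.incl j)⟦(1 : ℤ)⟧' = l (j + 1)) ∧
      (attachingDefect φ A B e m = 0 → ∀ j, l j = 0) := by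
    -- An arbitrary lift of zero may be nonzero and yield a nonzero bracket, so over a zero defect
    -- all lifts are taken to be zero.
    by_cases h : attachingDefect φ A B e m = 0
    · exact ⟨fun _ => 0, h.symm, by simp, by simp⟩
    · obtain ⟨l, h₁, h₂⟩ := exists_descending_choices
        (X := fun j => cell K m ⟶ (B.obj j)⟦(1 : ℤ)⟧)
        (fun j x y => y ≫ (B.incl j)⟦(1 : ℤ)⟧' = x) m (attachingDefect φ A B e m)
      exact ⟨l, h₁, h₂, fun h' => (h h').elim⟩
  choose l h₁ h₂ h₃ using H
  have hext (m : ℕ) (hm : n ≤ m) (hb : m < b) : IsExtension φ A B m (e m) (e (m + 1)) := by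
    rw [he m hb.le, he (m + 1) hb]
    exact hg m hm hb
  refine ⟨{ ext := e, lift := l, lift_self := fun m _ => h₁ m
            lift_spec := fun m j _ hm h => h₂ m j hm h
            ext_spec := fun m hm h => ?_ }, fun m j hm hb => ?_⟩
  · by_cases hb : m < b
    · exact hext m hm hb
    · exact he' m (not_lt.1 hb) h
  · exact h₃ m ((exists_isExtension_iff e hm).1 ⟨_, hext m hm hb⟩) j

namespace NullhomotopySystem

variable (S : NullhomotopySystem φ A B)

/-- If `T(m-j,j)` vanishes, or if `m = j + 1`, then `lift m (j+1)` projects to zero on the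
cell of degree `j`. -/
theorem lift_comp_proj_eq_zero {m j : ℕ} (hj : n ≤ j) (hjm : j < m)
    (hS : IsFilteredMap φ A B S.ext m) (h : j + 1 < m → S.toda (m - j) j = 0) :
    S.lift m (j + 1) ≫ (B.proj j)⟦(1 : ℤ)⟧' = 0 := by
  obtain rfl | hjm := Nat.eq_or_lt_of_le (Nat.succ_le_of_lt hjm)
  -- The case `m = j + 1` is the bracket of length one, which vanishes automatically.
  · rw [Nat.succ_eq_add_one, S.lift_self (j + 1) (by omega)]
    exact attachingDefect_comp_proj hj (hS j hj (by omega))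
  · obtain ⟨N, rfl⟩ := Nat.exists_eq_add_of_lt hjm
    have h' := h hjm
    rw [NullhomotopyData.toda_eq_zero_iff] at h'
    have : j + (j.succ + N + 1 - j) = j.succ + N + 1 := by omega
    rwa [this] at h'

theorem lift_comp_incl {m j : ℕ} (hj : n < j) (hjm : j < m)
    (hS : IsFilteredMap φ A B S.ext m) (h : j + 1 < m → S.toda (m - j) j = 0) :
    S.lift m j ≫ (B.incl j)⟦(1 : ℤ)⟧' = S.lift m (j + 1) :=
  S.lift_spec m j hj hjm (exists_lift_shift_of_dist (B.dist j hj.le) _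
    (S.lift_comp_proj_eq_zero hj.le hjm hS h))

theorem lift_eq_zero {m : ℕ} (hS : IsFilteredMap φ A B S.ext m)
    (h : ∀ j, n ≤ j → j + 1 < m → S.toda (m - j) j = 0) {j : ℕ} (hj : n < j) (hjm : j ≤ m) :
    S.lift m j = 0 := by
  induction j, hj using Nat.le_induction with
  | base =>
    -- The system imposes no condition on lifts to stage `n`, but some lift exists; it goes through
    -- the suspension of a zero object.
    obtain ⟨l, hl⟩ := exists_lift_shift_of_dist (B.dist n le_rfl) _
      (S.lift_comp_proj_eq_zero le_rfl hjm hS (h n le_rfl))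
    rw [Nat.succ_eq_add_one, ← hl, B.isZero.eq_of_src (B.incl n) 0, Functor.map_zero, comp_zero]
  | succ j hj ih =>
    rw [← S.lift_comp_incl hj hjm hS (h j (Nat.le_of_succ_le hj)), ih (by omega), zero_comp]

/-- If the brackets ending in the cells of degree less than `b` vanish, the maps of the system
form a filtration-preserving map. -/
theorem isFilteredMap {b : ℕ}
    (h : ∀ m j, m < b → n ≤ j → j + 1 < m → S.toda (m - j) j = 0) :
    IsFilteredMap φ A B S.ext b := by
  induction b with
  | zero => exact fun m _ hm => (Nat.not_lt_zero m hm).elim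
  | succ b ih =>
    have hb := ih fun m j hm => h m j (by omega)
    intro m hm hmb
    obtain hmb | rfl := Nat.lt_or_eq_of_le (Nat.le_of_lt_succ hmb)
    · exact hb m hm hmb
    refine S.ext_spec m hm ((exists_isExtension_iff _ hm).2 ?_)
    rw [← S.lift_self m hm]
    obtain hm | rfl := Nat.lt_or_eq_of_le hm
    · exact S.lift_eq_zero hb (fun j => h m j (by omega)) hm le_rfl
    · exact ((shiftFunctor 𝒯 (1 : ℤ)).map_isZero B.isZero).eq_of_tgt _ _

end NullhomotopySystem

/-- Induction from the zero stage: in a morphism of distinguished triangles, the middle map is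
invertible if the outer two are. -/
theorem IsFilteredMap.isIso {g : ∀ m, A.obj m ⟶ B.obj m} {b : ℕ}
    (hg : IsFilteredMap φ A B g b) (hφ : ∀ m, IsIso (φ.f m)) {m : ℕ} (hm : n ≤ m) (hb : m ≤ b) :
    IsIso (g m) := by
  induction m, hm using Nat.le_induction with
  | base => exact ⟨0, A.isZero.eq_of_src _ _, B.isZero.eq_of_src _ _⟩
  | succ m hm ih =>
    obtain ⟨h₁, h₂, h₃⟩ := hg m hm hb
    have := ih (by omega)
    have := hφ m
    let F : Triangle.mk (A.incl m) (A.proj m) (A.bd m) ⟶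
        Triangle.mk (B.incl m) (B.proj m) (B.bd m) :=
      { hom₁ := g m, hom₂ := g (m + 1), hom₃ := cellMap φ m, comm₁ := h₁, comm₂ := h₂
        comm₃ := h₃ }
    exact isIso₂_of_isIso₁₃ F (A.dist m hm) (B.dist m hm) ‹IsIso (g m)›
      (inferInstanceAs (IsIso ((shiftFunctor 𝒯 (m : ℤ)).map (φ.f m))))

end Maps

/-- A map of towers induces a map of homotopy colimits. -/
theorem Totalization.exists_map {C D : SimplicialObject 𝒯} (TC : Totalization C)
    (TD : Totalization D) (g : ∀ m, TC.tower.obj m ⟶ TD.tower.obj m)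
    (hg : ∀ m, TC.tower.incl m ≫ g (m + 1) = g m ≫ TD.tower.incl m) :
    ∃ G : TC.tot ⟶ TD.tot, ∀ m, TC.ι m ≫ G = g m ≫ TD.ι m := by
  let s : TC.sum.pt ⟶ TD.sum.pt :=
    Cofan.IsColimit.desc TC.isColimit fun m => g m ≫ TD.sum.inj m
  have hs (m : ℕ) : TC.sum.inj m ≫ s = g m ≫ TD.sum.inj m := Cofan.IsColimit.fac _ _ _
  have comm : (𝟙 TC.sum.pt - Cofan.IsColimit.desc TC.isColimit
        (fun m => TC.tower.incl m ≫ TC.sum.inj (m + 1))) ≫ s =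
      s ≫ (𝟙 TD.sum.pt - Cofan.IsColimit.desc TD.isColimit
        (fun m => TD.tower.incl m ≫ TD.sum.inj (m + 1))) := by
    refine Cofan.IsColimit.hom_ext TC.isColimit _ _ fun m => ?_
    rw [Preadditive.sub_comp, Preadditive.comp_sub, Preadditive.comp_sub, Preadditive.comp_sub,
      Category.id_comp, Category.comp_id, Cofan.IsColimit.fac_assoc, Category.assoc, hs,
      reassoc_of% hs, hs (m + 1), reassoc_of% (hg m), Cofan.IsColimit.fac TD.isColimit]
  obtain ⟨(G : TC.tot ⟶ TD.tot), (hG : TC.fromSum ≫ G = s ≫ TD.fromSum), -⟩ :=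
    Pretriangulated.complete_distinguished_triangle_morphism _ _ TC.dist TD.dist s s comm
  refine ⟨G, fun m => ?_⟩
  rw [Totalization.ι, Totalization.ι, Category.assoc, hG, reassoc_of% hs]

end

end TotObstruction

/-! ### The theorem: matching the ranges of brackets with the cells -/

theorem mainTheorem2 {𝒯 : Type u} [Category.{v} 𝒯] [HasZeroObject 𝒯] [HasShift 𝒯 ℤ]
    [Preadditive 𝒯] [∀ n : ℤ, (shiftFunctor 𝒯 n).Additive] [Pretriangulated 𝒯]
    [IsTriangulated 𝒯] (C D : SimplicialObject 𝒯) (f : C ⟶ D)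
    (TC : Totalization C) (TD : Totalization D) :
    -- extensions to the subquotients with cells in degrees `n, …, n + k - 1`
    (∀ (n k : ℕ) (A : GrTower TC.tower n) (B : GrTower TD.tower n),
      3 ≤ k →
      ((∃ g, IsFilteredMap ((alternatingFaceMapComplex 𝒯).map f)
            A.toCellTower B.toCellTower g (n + k)) ↔
        ∃ S : NullhomotopySystem ((alternatingFaceMapComplex 𝒯).map f)
            A.toCellTower B.toCellTower,
          ∀ N i : ℕ, 2 ≤ N → N < k → n ≤ i → N + i < n + k → S.toda N i = 0) ∧
      (∀ S : NullhomotopySystem ((alternatingFaceMapComplex 𝒯).map f)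
            A.toCellTower B.toCellTower,
          (∀ N i : ℕ, 2 ≤ N → N < k → n ≤ i → N + i ≤ n + k → S.toda N i = 0) →
          S.IsDefined k n)) ∧
    -- the map on the whole totalization
    ((∃ S : NullhomotopySystem ((alternatingFaceMapComplex 𝒯).map f)
          TC.tower TD.tower,
        ∀ N i : ℕ, 2 ≤ N → S.toda N i = 0) →
      ∃ (g : ∀ m, TC.tower.obj m ⟶ TD.tower.obj m) (G : TC.tot ⟶ TD.tot),
        (∀ b, IsFilteredMap ((alternatingFaceMapComplex 𝒯).map f)
          TC.tower TD.tower g b) ∧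
        ∀ m, TC.ι m ≫ G = g m ≫ TD.ι m) ∧
    -- weak equivalences
    ((∀ m : ℕ, IsIso (f.app (op ⦋m⦌))) →
      (∀ (n k : ℕ) (A : GrTower TC.tower n)
        (B : GrTower TD.tower n) (g : ∀ m, A.obj m ⟶ B.obj m),
        IsFilteredMap ((alternatingFaceMapComplex 𝒯).map f)
          A.toCellTower B.toCellTower g (n + k) →
        ∀ m, n ≤ m → m ≤ n + k → IsIso (g m)) ∧
      (∀ (b : ℕ) (g : ∀ m, TC.tower.obj m ⟶ TD.tower.obj m),
        IsFilteredMap ((alternatingFaceMapComplex 𝒯).map f)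
          TC.tower TD.tower g b →
        ∀ m, m ≤ b → IsIso (g m))) := by
  refine ⟨fun n k A B _ => ⟨⟨?_, ?_⟩, fun S hS => ⟨?_, ?_⟩⟩, ?_, fun hf => ⟨?_, ?_⟩⟩
  · rintro ⟨g, hg⟩
    obtain ⟨S, hS⟩ := exists_nullhomotopySystem g _ hg
    refine ⟨S, fun N i _ _ hi h => ?_⟩
    rw [NullhomotopyData.toda_eq_zero_iff, hS _ _ (by omega) (by omega), zero_comp]
  · rintro ⟨S, hS⟩
    -- A bracket from a cell of degree `m < n + k` into degree `j ≥ n` has length `m - j < k`.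
    exact ⟨S.ext, S.isFilteredMap fun m j _ hj _ =>
      hS _ _ (by omega) (by omega) hj (by omega)⟩
  · exact S.isFilteredMap fun m j _ hj _ => hS _ _ (by omega) (by omega) hj (by omega)
  -- On the cell of degree `n + k`, only lifts to stages `j > n` are needed, so the brackets used
  -- have length `n + k - j < k`.
  · exact fun j hj hjk => S.lift_comp_incl hj hjk
      (S.isFilteredMap fun m j _ hj _ => hS _ _ (by omega) (by omega) hj (by omega))
      fun _ => hS _ _ (by omega) (by omega) hj.le (by omega)
  · rintro ⟨S, hS⟩
    have h (b : ℕ) := S.isFilteredMap (b := b) fun m j _ _ _ => hS (m - j) j (by omega)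
    obtain ⟨G, hG⟩ := TC.exists_map TD S.ext fun m =>
      (h (m + 1) m (Nat.zero_le m) (Nat.lt_succ_self m)).1
    exact ⟨S.ext, G, h, hG⟩
  · exact fun n k A B g hg m hm hmk => hg.isIso hf hm hmk
  · exact fun b g hg m hm => hg.isIso hf (Nat.zero_le m) hm
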